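/- Let $N\ge 0$ be an integer, let $L_1,\dots,L_N\in\mathbb C$ be pairwise distinct with $L_j\neq L_k^{*}$ for all $j,k$ (so that no $L_k$ is real), let $f_{0k},\varphi_{0k}\in\mathbb R$ ($k=1,\dots,N$) be arbitrary constants, and let $\mathsf U$ be an arbitrary constant unitary $2\times2$ matrix. Here $^{*}$ denotes complex conjugation, taken entrywise (without transposition) for matrices, and $^{\dagger}$ denotes the Hermitian conjugate. Put $$\mathsf L=\operatorname{diag}(L_1,\dots,L_N),\qquad \mathsf C=\Bigl(\frac{1}{L_j-L_k^{*}}\Bigr)_{j,k=1,\dots,N},\qquad \mu_k+i\nu_k=\frac{L_k}{|L_k|^2},$$ $$f_k(t,x)=\nu_kx+2\mu_k\nu_kt+f_{0k},\qquad \varphi_k(t,x)=-\mu_kx+(\nu_k^2-\mu_k^2)t+\varphi_{0k},$$ $$\mathsf E=\operatorname{diag}\bigl(e^{f_k+i\varphi_k}\bigr)_{k=1,\dots,N},\qquad \mathsf Y=\mathsf C\mathsf E,\qquad \mathsf\Omega=\mathsf Y(1+\mathsf Y^{*}\mathsf Y)^{-1},$$ $$\langle 1|=(1,\dots,1),\qquad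 |1\rangle=(1,\dots,1)^{T},\qquad \langle\gamma|=\langle1|(\mathsf C\mathsf L^{*})^{-1}.$$ Then $\mathsf C\mathsf L^{*}$ is invertible, $1+\mathsf Y^{*}\mathsf Y$ is invertible for all $(t,x)\in\mathbb R^2$, and the function $\psi:\mathbb R^2\to\mathbb C^2$ given by $$\psi(t,x)=\mathsf U\begin{pmatrix}\langle\gamma|\mathsf\Omega|1\rangle\\ 1+\langle\gamma|\mathsf\Omega\mathsf Y^{*}|1\rangle\end{pmatrix}$$ is infinitely differentiable, satisfies the constraint $\psi^{\dagger}\psi=1$ on all of $\mathbb R^2$, and solves the Euler–Lagrange equations $$i\psi_t+\psi_{xx}+\lambda\psi=0,\qquad -i\psi^{\dagger}_t+\psi^{\dagger}_{xx}+\lambda\psi^{\dagger}=0,\qquad \lambda=\operatorname{Im}(\psi^{\dagger}\psi_t)+\psi_x^{\dagger}\psi_x,$$ on all of $\mathbb R^2$. Thus the matrix $\mathsf U$ and the $4N$ real constants $\operatorname{Re}L_k,\operatorname{Im}L_k,f_{0k},\varphi_{0k}$ are free parameters (subject only to the stated conditions) of this family of $N$-soliton solutions. -/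

import Mathlib

open scoped Matrix

noncomputable section

namespace ConstrainedNLS

/-! ## The constrained Schrödinger equations

A field is a function `ψ : ℝ → ℝ → (Fin 2 → ℂ)`, written `ψ t x`. -/

/-- Partial derivative in the first variable `t`. -/
def dt (ψ : ℝ → ℝ → (Fin 2 → ℂ)) (t x : ℝ) : Fin 2 → ℂ :=
  deriv (fun s : ℝ => ψ s x) t

/-- Partial derivative in the second variable `x`. -/
def dx (ψ : ℝ → ℝ → (Fin 2 → ℂ)) (t x : ℝ) : Fin 2 → ℂ :=
  deriv (fun y : ℝ => ψ t y) x

/-- The Hermitian conjugate `ψ†` (a row, again represented by its two entries). -/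
def dagger (ψ : ℝ → ℝ → (Fin 2 → ℂ)) (t x : ℝ) : Fin 2 → ℂ :=
  star (ψ t x)

/-- The Lagrange multiplier `λ = Im (ψ† ψ_t) + ψ†_x ψ_x`. -/
def multiplier (ψ : ℝ → ℝ → (Fin 2 → ℂ)) (t x : ℝ) : ℂ :=
  ((dagger ψ t x ⬝ᵥ dt ψ t x).im : ℂ) + dx (dagger ψ) t x ⬝ᵥ dx ψ t x

/-- The constraint `ψ† ψ = 1` at every point. -/
def SatisfiesConstraint (ψ : ℝ → ℝ → (Fin 2 → ℂ)) : Prop :=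
  ∀ t x : ℝ, dagger ψ t x ⬝ᵥ ψ t x = 1

/-- The Euler–Lagrange equations `i ψ_t + ψ_xx + λ ψ = 0` and `-i ψ†_t + ψ†_xx + λ ψ† = 0`, with
`λ = Im (ψ† ψ_t) + ψ†_x ψ_x`. -/
def SolvesEulerLagrange (ψ : ℝ → ℝ → (Fin 2 → ℂ)) : Prop :=
  ∀ t x : ℝ,
    Complex.I • dt ψ t x + dx (dx ψ) t x + multiplier ψ t x • ψ t x = 0 ∧
    -Complex.I • dt (dagger ψ) t x + dx (dx (dagger ψ)) t x
      + multiplier ψ t x • dagger ψ t x = 0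

/-! ## The soliton data -/

variable {N : ℕ}

/-- Entrywise complex conjugate of a matrix (no transposition), written `M^*` below. -/
def conjMat (M : Matrix (Fin N) (Fin N) ℂ) : Matrix (Fin N) (Fin N) ℂ :=
  M.map (starRingEnd ℂ)

/-- `𝖫 = diag(L₁, …, L_N)`. -/
def matL (L : Fin N → ℂ) : Matrix (Fin N) (Fin N) ℂ :=
  Matrix.diagonal L

/-- `𝖢 = (1 / (L_j - L_k^*))`. -/
def matC (L : Fin N → ℂ) : Matrix (Fin N) (Fin N) ℂ :=
  Matrix.of fun j k => 1 / (L j - starRingEnd ℂ (L k))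

/-- `μ_k = Re (L_k / |L_k|²)`. -/
def mu (L : Fin N → ℂ) (k : Fin N) : ℝ := (L k / ((‖L k‖ : ℂ) ^ 2)).re

/-- `ν_k = Im (L_k / |L_k|²)`. -/
def nu (L : Fin N → ℂ) (k : Fin N) : ℝ := (L k / ((‖L k‖ : ℂ) ^ 2)).im

/-- `f_k(t,x) = ν_k x + 2 μ_k ν_k t + f_{0k}`. -/
def f (L : Fin N → ℂ) (f₀ : Fin N → ℝ) (t x : ℝ) (k : Fin N) : ℝ :=
  nu L k * x + 2 * mu L k * nu L k * t + f₀ k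

/-- `φ_k(t,x) = -μ_k x + (ν_k² - μ_k²) t + φ_{0k}`. -/
def phi (L : Fin N → ℂ) (φ₀ : Fin N → ℝ) (t x : ℝ) (k : Fin N) : ℝ :=
  -mu L k * x + (nu L k ^ 2 - mu L k ^ 2) * t + φ₀ k

/-- `𝖤(t,x) = diag(exp (f_k + i φ_k))`. -/
def matE (L : Fin N → ℂ) (f₀ φ₀ : Fin N → ℝ) (t x : ℝ) : Matrix (Fin N) (Fin N) ℂ :=
  Matrix.diagonal fun k => Complex.exp ((f L f₀ t x k : ℂ) + Complex.I * (phi L φ₀ t x k : ℂ))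

/-- `𝖸 = 𝖢 𝖤`. -/
def matY (L : Fin N → ℂ) (f₀ φ₀ : Fin N → ℝ) (t x : ℝ) : Matrix (Fin N) (Fin N) ℂ :=
  matC L * matE L f₀ φ₀ t x

/-- `𝖬 = 1 + 𝖸^* 𝖸`, the matrix that is inverted in `Ω`. -/
def matM (L : Fin N → ℂ) (f₀ φ₀ : Fin N → ℝ) (t x : ℝ) : Matrix (Fin N) (Fin N) ℂ :=
  1 + conjMat (matY L f₀ φ₀ t x) * matY L f₀ φ₀ t x

/-- `Ω = 𝖸 (1 + 𝖸^* 𝖸)⁻¹`. -/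
def matOmega (L : Fin N → ℂ) (f₀ φ₀ : Fin N → ℝ) (t x : ℝ) : Matrix (Fin N) (Fin N) ℂ :=
  matY L f₀ φ₀ t x * (matM L f₀ φ₀ t x)⁻¹

/-- The constant row `⟨γ| = ⟨1| (𝖢 𝖫^*)⁻¹`. -/
def gammaRow (L : Fin N → ℂ) : Fin N → ℂ :=
  (fun _ => 1) ᵥ* (matC L * conjMat (matL L))⁻¹

/-- The field `ψ = U (⟨γ|Ω|1⟩, 1 + ⟨γ|Ω 𝖸^*|1⟩)ᵀ`. -/
def soliton (U : Matrix (Fin 2) (Fin 2) ℂ) (L : Fin N → ℂ) (f₀ φ₀ : Fin N → ℝ) (t x : ℝ) :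
    Fin 2 → ℂ :=
  U *ᵥ ![gammaRow L ⬝ᵥ (matOmega L f₀ φ₀ t x *ᵥ fun _ => 1),
    1 + gammaRow L ⬝ᵥ ((matOmega L f₀ φ₀ t x * conjMat (matY L f₀ φ₀ t x)) *ᵥ fun _ => 1)]

end ConstrainedNLS

end

open scoped ComplexConjugate

namespace ConstrainedNLS

variable {N : ℕ}

/-! With `a` = E(1+Y^*Y)⁻¹|1⟩, `b` = E(Y(1+Y^*Y)⁻¹|1⟩)^* and ε the conjugate of E⁻¹, the definition
of Ω becomes the real-linear system conj(a)ε + Cb = 1, conj(b)ε - Ca = 0, and ψ = U(v, w) with v =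
⟨1|(L^*)⁻¹|a⟩, w = 1 + ⟨1|(L^*)⁻¹|b⟩.

The displacement identity LC - CL^* = |1⟩⟨1| drives everything. Through `cauchy_pairing` it gives
the constraint (`conj_mul_self_add_eq_one`) and makes the entry sums of any homogeneous solution
vanish. Multiplication by L^* then preserves homogeneous solutions, so all power sums vanish and a
Vandermonde argument gives uniqueness (`eq_zero_of_homogeneous`). Invertibility of C and of 1+Y^*Y
are special cases.

Uniqueness also identifies derivatives: a candidate solving the linearized system must be the
derivative (`deriv_eq_of_linearized`). The candidates `flowX` and `flowT` express the derivatives of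
(a, b) through (L^*)⁻¹, a, b and (v, w). Writing mₙ for the pair of n-th moments of a, b, and P for
-i times the projection orthogonal to (v, w), they give ψ_x = P m₂ and ψ_t = P m₃ + (ψψ_x† -
ψ_xψ†)m₂, up to U. The equation follows with λ = 2ψ_x†ψ_x (`solves_of_system`). -/

/-- The action of the Cauchy matrix `1 / (L_j - L_k^*)` on a column. -/
noncomputable def cauchy (L p : Fin N → ℂ) (j : Fin N) : ℂ := ∑ k, p k / (L j - conj (L k))

/-- The weighted sum `∑ p_k / (L_k^*)^n`. -/
noncomputable def moment (L : Fin N → ℂ) (n : ℕ) (p : Fin N → ℂ) : ℂ :=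
  ∑ k, (conj (L k))⁻¹ ^ n * p k

/-! ### Linearity of the Cauchy action and of the moments. -/

theorem cauchy_add (L p q : Fin N → ℂ) (j : Fin N) :
    cauchy L (fun k => p k + q k) j = cauchy L p j + cauchy L q j := by
  simp [cauchy, add_div, Finset.sum_add_distrib]

theorem cauchy_const_mul (L p : Fin N → ℂ) (c : ℂ) (j : Fin N) :
    cauchy L (fun k => c * p k) j = c * cauchy L p j := by
  simp [cauchy, mul_div_assoc, Finset.mul_sum]

theorem moment_add (L p q : Fin N → ℂ) (n : ℕ) :
    moment L n (fun k => p k + q k) = moment L n p + moment L n q := by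
  simp [moment, mul_add, Finset.sum_add_distrib]

theorem moment_const_mul (L p : Fin N → ℂ) (c : ℂ) (n : ℕ) :
    moment L n (fun k => c * p k) = c * moment L n p := by
  simp only [moment, Finset.mul_sum]
  exact Finset.sum_congr rfl fun k _ => by ring

theorem moment_inv_mul (L p : Fin N → ℂ) (n : ℕ) :
    moment L n (fun k => (conj (L k))⁻¹ * p k) = moment L (n + 1) p := by
  simp only [moment]
  exact Finset.sum_congr rfl fun k _ => by ring

theorem conj_moment (L p : Fin N → ℂ) (n : ℕ) :
    conj (moment L n p) = ∑ k, conj (p k) * (L k)⁻¹ ^ n := by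
  simp only [moment, map_sum, map_mul, map_pow, map_inv₀, Complex.conj_conj, mul_comm]

/-! ### The displacement identity and uniqueness for the homogeneous system. -/

section Pairing

variable {L : Fin N → ℂ} (hL : ∀ j k : Fin N, L j ≠ conj (L k))
include hL

theorem ne_zero_of_ne_conj (k : Fin N) : L k ≠ 0 := by
  intro h
  apply hL k k
  simp [h]

/-- Entrywise, L_k^*/(L_j - L_k^*) = L_j/(L_j - L_k^*) - 1. -/
theorem cauchy_conj_mul (p : Fin N → ℂ) (j : Fin N) :
    cauchy L (fun k => conj (L k) * p k) j = L j * cauchy L p j - ∑ k, p k := by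
  simp only [cauchy, Finset.mul_sum, ← Finset.sum_sub_distrib]
  refine Finset.sum_congr rfl fun k _ => ?_
  have := sub_ne_zero.2 (hL j k)
  field_simp
  ring

/-- Partial fractions: 1/(L_k^*(L_j - L_k^*)) = L_j⁻¹(1/(L_j - L_k^*) + 1/L_k^*). -/
theorem cauchy_inv_mul (p : Fin N → ℂ) (j : Fin N) :
    cauchy L (fun k => (conj (L k))⁻¹ * p k) j = (L j)⁻¹ * (cauchy L p j + moment L 1 p) := by
  simp only [cauchy, moment, Finset.mul_sum, ← Finset.sum_add_distrib]
  refine Finset.sum_congr rfl fun k _ => ?_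
  have h1 := sub_ne_zero.2 (hL j k)
  have h2 := ne_zero_of_ne_conj hL j
  have h3 : conj (L k) ≠ 0 := by simpa using ne_zero_of_ne_conj hL k
  field_simp
  ring

/-- The anti-Hermitian Cauchy matrix `C` satisfies `L C - C L^* = |1⟩⟨1|`. -/
theorem cauchy_pairing (p q : Fin N → ℂ) :
    conj (∑ j, p j) * ∑ k, q k =
      ∑ j, conj (p j) * L j * cauchy L q j + conj (∑ j, conj (q j) * L j * cauchy L p j) := by
  simp only [cauchy, map_sum, map_mul, map_div₀, map_sub, Complex.conj_conj, Finset.mul_sum,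
    Finset.sum_mul]
  rw [Finset.sum_comm]
  nth_rewrite 3 [Finset.sum_comm]
  simp only [← Finset.sum_add_distrib]
  refine Finset.sum_congr rfl fun j _ => Finset.sum_congr rfl fun k _ => ?_
  have h1 := sub_ne_zero.2 (hL j k)
  have h2 : conj (L k) - L j ≠ 0 := by rw [← neg_sub]; exact neg_ne_zero.2 h1
  rw [← neg_sub (L j), div_neg]
  field_simp
  ring

/-- Pairing `a` with itself and `b` with itself produces opposite right-hand sides, so |∑a|² + |∑b|²
= 0. No condition on `ε` is needed, so ε = 0 is allowed. -/
theorem sum_eq_zero_of_homogeneous {ε a b : Fin N → ℂ}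
    (h1 : ∀ j, conj (a j) * ε j + cauchy L b j = 0)
    (h2 : ∀ j, conj (b j) * ε j - cauchy L a j = 0) : ∑ k, a k = 0 ∧ ∑ k, b k = 0 := by
  have ha : ∀ j, cauchy L a j = conj (b j) * ε j := fun j => (sub_eq_zero.1 (h2 j)).symm
  have hb : ∀ j, cauchy L b j = -(conj (a j) * ε j) := fun j => by linear_combination h1 j
  have pa := cauchy_pairing hL a a
  have pb := cauchy_pairing hL b b
  simp only [ha] at pa
  simp only [hb] at pb
  have e : ∑ j, conj (b j) * L j * -(conj (a j) * ε j) =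
      -∑ j, conj (a j) * L j * (conj (b j) * ε j) := by
    rw [← Finset.sum_neg_distrib]
    exact Finset.sum_congr rfl fun j _ => by ring
  rw [e] at pb
  have key : conj (∑ j, a j) * ∑ k, a k + conj (∑ j, b j) * ∑ k, b k = 0 := by
    rw [pa, pb, map_neg]; ring
  rw [← Complex.normSq_eq_conj_mul_self, ← Complex.normSq_eq_conj_mul_self] at key
  have key' : Complex.normSq (∑ k, a k) + Complex.normSq (∑ k, b k) = 0 := by exact_mod_cast key
  have na := Complex.normSq_nonneg (∑ k, a k)
  have nb := Complex.normSq_nonneg (∑ k, b k)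
  exact ⟨Complex.normSq_eq_zero.1 (by linarith), Complex.normSq_eq_zero.1 (by linarith)⟩

theorem eq_zero_of_homogeneous (hinj : Function.Injective L) {ε a b : Fin N → ℂ}
    (h1 : ∀ j, conj (a j) * ε j + cauchy L b j = 0)
    (h2 : ∀ j, conj (b j) * ε j - cauchy L a j = 0) : a = 0 ∧ b = 0 := by
  have hpow : ∀ n : ℕ, (∑ k, conj (L k) ^ n * a k = 0) ∧ (∑ k, conj (L k) ^ n * b k = 0) ∧
      (∀ j, conj (conj (L j) ^ n * a j) * ε j + cauchy L (fun k => conj (L k) ^ n * b k) j = 0) ∧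
      (∀ j, conj (conj (L j) ^ n * b j) * ε j - cauchy L (fun k => conj (L k) ^ n * a k) j = 0) := by
    intro n
    induction n with
    | zero =>
      obtain ⟨sa, sb⟩ := sum_eq_zero_of_homogeneous hL h1 h2
      simpa using ⟨sa, sb, h1, h2⟩
    | succ n ih =>
      obtain ⟨sa, sb, i1, i2⟩ := ih
      have step : ∀ p : Fin N → ℂ, (fun k => conj (L k) ^ (n + 1) * p k) =
          fun k => conj (L k) * (conj (L k) ^ n * p k) := fun p => funext fun k => by ring
      have j1 : ∀ j, conj (conj (L j) ^ (n + 1) * a j) * ε j +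
          cauchy L (fun k => conj (L k) ^ (n + 1) * b k) j = 0 := fun j => by
        have := i1 j
        -- The vanishing sum removes the rank-one term, so the new equation is `L j` times the old
        -- one.
        rw [step, cauchy_conj_mul hL, sb]
        simp only [map_mul, map_pow, Complex.conj_conj] at this ⊢
        linear_combination L j * this
      have j2 : ∀ j, conj (conj (L j) ^ (n + 1) * b j) * ε j -
          cauchy L (fun k => conj (L k) ^ (n + 1) * a k) j = 0 := fun j => by
        have := i2 j
        rw [step, cauchy_conj_mul hL, sa]
        simp only [map_mul, map_pow, Complex.conj_conj] at this ⊢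
        linear_combination L j * this
      obtain ⟨ta, tb⟩ := sum_eq_zero_of_homogeneous hL
        (a := fun k => conj (L k) ^ (n + 1) * a k) (b := fun k => conj (L k) ^ (n + 1) * b k) j1 j2
      exact ⟨ta, tb, j1, j2⟩
  -- All power sums over the distinct nodes L_k^* vanish: Vandermonde.
  have hinj' : Function.Injective fun k => conj (L k) := fun j k h =>
    hinj ((starRingEnd ℂ).injective h)
  refine ⟨Matrix.eq_zero_of_forall_pow_sum_mul_pow_eq_zero hinj' fun i => ?_,
    Matrix.eq_zero_of_forall_pow_sum_mul_pow_eq_zero hinj' fun i => ?_⟩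
  · simpa [mul_comm] using (hpow i).1
  · simpa [mul_comm] using (hpow i).2.1

/-! ### The constraint -/

section System

variable {ε a b : Fin N → ℂ} (h1 : ∀ j, conj (a j) * ε j + cauchy L b j = 1)
    (h2 : ∀ j, conj (b j) * ε j - cauchy L a j = 0)
include h1 h2

/-- Apply the pairing to (L^*)⁻¹a and (L^*)⁻¹b. The mixed term `R` enters the two identities with
opposite signs and cancels in their sum. -/
theorem conj_mul_self_add_eq_one :
    conj (moment L 1 a) * moment L 1 a + conj (1 + moment L 1 b) * (1 + moment L 1 b) = 1 := by
  have ha : ∀ j, cauchy L a j = conj (b j) * ε j := fun j => (sub_eq_zero.1 (h2 j)).symm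
  have hb : ∀ j, cauchy L b j = 1 - conj (a j) * ε j := fun j => by linear_combination h1 j
  set R := ∑ j, conj (a j) * conj (b j) * ε j * (L j)⁻¹ with hR
  have hsum : ∀ p : Fin N → ℂ, ∑ k, (conj (L k))⁻¹ * p k = moment L 1 p := fun p => by
    simp [moment]
  have ea : ∑ j, conj ((conj (L j))⁻¹ * a j) * L j *
      cauchy L (fun k => (conj (L k))⁻¹ * a k) j = R + conj (moment L 1 a) * moment L 1 a := by
    rw [conj_moment, Finset.sum_mul, hR, ← Finset.sum_add_distrib]
    refine Finset.sum_congr rfl fun j _ => ?_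
    rw [cauchy_inv_mul hL, ha]
    have := ne_zero_of_ne_conj hL j
    simp only [map_mul, map_inv₀, Complex.conj_conj]
    field_simp
  have eb : ∑ j, conj ((conj (L j))⁻¹ * b j) * L j *
      cauchy L (fun k => (conj (L k))⁻¹ * b k) j =
      conj (moment L 1 b) - R + conj (moment L 1 b) * moment L 1 b := by
    rw [conj_moment, Finset.sum_mul, hR, ← Finset.sum_sub_distrib, ← Finset.sum_add_distrib]
    refine Finset.sum_congr rfl fun j _ => ?_
    rw [cauchy_inv_mul hL, hb]
    have := ne_zero_of_ne_conj hL j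
    simp only [map_mul, map_inv₀, Complex.conj_conj]
    field_simp
  have pa := cauchy_pairing hL (fun k => (conj (L k))⁻¹ * a k) fun k => (conj (L k))⁻¹ * a k
  have pb := cauchy_pairing hL (fun k => (conj (L k))⁻¹ * b k) fun k => (conj (L k))⁻¹ * b k
  rw [ea] at pa
  rw [eb] at pb
  simp only [hsum, map_add, map_sub, map_mul, Complex.conj_conj, map_one] at pa pb ⊢
  linear_combination -pa - pb

end System

end Pairing

/-- The derivative of a solution of the inhomogeneous system is the solution of the linearized
system. -/
theorem deriv_eq_of_linearized {L : Fin N → ℂ} (hL : ∀ j k : Fin N, L j ≠ conj (L k))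
    (hinj : Function.Injective L) {ε a b : ℝ → Fin N → ℂ} {s : ℝ} {ε' a' b' : Fin N → ℂ}
    (h1 : ∀ r j, conj (a r j) * ε r j + cauchy L (b r) j = 1)
    (h2 : ∀ r j, conj (b r j) * ε r j - cauchy L (a r) j = 0)
    (hε : ∀ j, HasDerivAt (fun r => ε r j) (ε' j) s)
    (ha : ∀ j, DifferentiableAt ℝ (fun r => a r j) s)
    (hb : ∀ j, DifferentiableAt ℝ (fun r => b r j) s)
    (l1 : ∀ j, conj (a' j) * ε s j + conj (a s j) * ε' j + cauchy L b' j = 0)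
    (l2 : ∀ j, conj (b' j) * ε s j + conj (b s j) * ε' j - cauchy L a' j = 0) :
    (∀ j, HasDerivAt (fun r => a r j) (a' j) s) ∧ ∀ j, HasDerivAt (fun r => b r j) (b' j) s := by
  have hc : ∀ {c : ℝ → Fin N → ℂ} (j), (∀ j, DifferentiableAt ℝ (fun r => c r j) s) →
      HasDerivAt (fun r => cauchy L (c r) j) (cauchy L (fun k => deriv (fun r => c r k) s) j) s :=
    fun j h => HasDerivAt.fun_sum fun k _ => (h k).hasDerivAt.div_const _
  have d1 : ∀ j, conj (deriv (fun r => a r j) s) * ε s j + conj (a s j) * ε' j +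
      cauchy L (fun k => deriv (fun r => b r k) s) j = 0 := fun j =>
    ((((ha j).hasDerivAt.star.mul (hε j)).add (hc j hb)).unique
      ((hasDerivAt_const s (1 : ℂ)).congr_of_eventuallyEq (.of_forall fun r => h1 r j)))
  have d2 : ∀ j, conj (deriv (fun r => b r j) s) * ε s j + conj (b s j) * ε' j -
      cauchy L (fun k => deriv (fun r => a r k) s) j = 0 := fun j =>
    ((((hb j).hasDerivAt.star.mul (hε j)).sub (hc j ha)).unique
      ((hasDerivAt_const s (0 : ℂ)).congr_of_eventuallyEq (.of_forall fun r => h2 r j)))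
  have csub : ∀ (p q : Fin N → ℂ) j, cauchy L (fun k => p k - q k) j =
      cauchy L p j - cauchy L q j := fun p q j => by
    simp [cauchy, sub_div, Finset.sum_sub_distrib]
  -- The true derivative and the candidate solve the same linearized system, so their difference is
  -- homogeneous.
  obtain ⟨za, zb⟩ := eq_zero_of_homogeneous hL hinj (ε := ε s)
    (a := fun k => deriv (fun r => a r k) s - a' k)
    (b := fun k => deriv (fun r => b r k) s - b' k)
    (fun j => by rw [csub, map_sub]; linear_combination d1 j - l1 j)
    (fun j => by rw [csub, map_sub]; linear_combination d2 j - l2 j)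
  exact ⟨fun j => (sub_eq_zero.1 (congrFun za j)) ▸ (ha j).hasDerivAt,
    fun j => (sub_eq_zero.1 (congrFun zb j)) ▸ (hb j).hasDerivAt⟩

/-! ### The flows in `x` and `t` of the inhomogeneous system -/

/-- The column `(L^*)⁻¹ (α p + β q)`. -/
noncomputable def invComb (L p q : Fin N → ℂ) (α β : ℂ) (k : Fin N) : ℂ :=
  (conj (L k))⁻¹ * (α * p k + β * q k)

theorem moment_invComb (L p q : Fin N → ℂ) (α β : ℂ) (n : ℕ) :
    moment L n (invComb L p q α β) = α * moment L (n + 1) p + β * moment L (n + 1) q := by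
  unfold invComb
  rw [moment_inv_mul, moment_add, moment_const_mul, moment_const_mul]

theorem cauchy_invComb {L : Fin N → ℂ} (hL : ∀ j k : Fin N, L j ≠ conj (L k)) (p q : Fin N → ℂ)
    (α β : ℂ) (j : Fin N) :
    cauchy L (invComb L p q α β) j = (L j)⁻¹ *
      (α * (cauchy L p j + moment L 1 p) + β * (cauchy L q j + moment L 1 q)) := by
  unfold invComb
  rw [cauchy_inv_mul hL, cauchy_add, cauchy_const_mul, cauchy_const_mul, moment_add,
    moment_const_mul, moment_const_mul]
  ring

theorem conj_invComb (L p q : Fin N → ℂ) (α β : ℂ) (k : Fin N) :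
    conj (invComb L p q α β k) = (L k)⁻¹ * (conj α * conj (p k) + conj β * conj (q k)) := by
  simp [invComb]

/-- The orthogonal projection of the vector `(p, q)` along `(v, w)`, times `-i`: first entry. -/
noncomputable def transverse (v w p q : ℂ) : ℂ :=
  -Complex.I * (p - v * (conj v * p + conj w * q))

/-- The first column of the `x`-derivative of the solution `(a, b)`. -/
noncomputable def flowX (L a b : Fin N → ℂ) (v w : ℂ) : Fin N → ℂ :=
  invComb L a b (-Complex.I * (1 - v * conj v)) (Complex.I * v * conj w)

/-- The first column of the `t`-derivative of the solution `(a, b)`. -/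
noncomputable def flowT (L a b : Fin N → ℂ) (v w v' w' : ℂ) : Fin N → ℂ := fun k =>
  invComb L (flowX L a b v w) 0 1 0 k +
    invComb L a b (v * conj v' - v' * conj v) (v * conj w' - v' * conj w) k

theorem moment_flowX (L a b : Fin N → ℂ) (v w : ℂ) (n : ℕ) :
    moment L n (flowX L a b v w) = transverse v w (moment L (n + 1) a) (moment L (n + 1) b) := by
  rw [flowX, moment_invComb, transverse]; ring

theorem moment_flowT (L a b : Fin N → ℂ) (v w v' w' : ℂ) (n : ℕ) :
    moment L n (flowT L a b v w v' w') =
      transverse v w (moment L (n + 2) a) (moment L (n + 2) b) +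
      ((v * conj v' - v' * conj v) * moment L (n + 1) a +
        (v * conj w' - v' * conj w) * moment L (n + 1) b) := by
  unfold flowT
  rw [moment_add, moment_invComb, moment_invComb, moment_flowX]
  simp

/-! ### The candidate flows satisfy the linearized system. -/

section Linearized

variable {L : Fin N → ℂ} (hL : ∀ j k : Fin N, L j ≠ conj (L k)) {a b : Fin N → ℂ} {v w : ℂ}
  (hv : moment L 1 a = v) (hw : 1 + moment L 1 b = w) (hc : conj v * v + conj w * w = 1)
include hL hv hw hc

/-- The system is symmetric enough that the second column is `flowX` with (a, v) and (b, w)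
exchanged. After elimination of Ca and Cb, each defect is a multiple of |v|² + |w|² - 1. -/
theorem linearized_x {e : ℂ} {j : Fin N} (h1 : conj (a j) * e + cauchy L b j = 1)
    (h2 : conj (b j) * e - cauchy L a j = 0) :
    conj (flowX L a b v w j) * e + conj (a j) * (-Complex.I * (L j)⁻¹ * e) +
        cauchy L (flowX L b a w v) j = 0 ∧
      conj (flowX L b a w v j) * e + conj (b j) * (-Complex.I * (L j)⁻¹ * e) -
        cauchy L (flowX L a b v w) j = 0 := by
  have ha : cauchy L a j = conj (b j) * e := (sub_eq_zero.1 h2).symm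
  have hb : cauchy L b j = 1 - conj (a j) * e := by linear_combination h1
  have hw' : moment L 1 b = w - 1 := by linear_combination hw
  simp only [flowX, cauchy_invComb hL, conj_invComb, ha, hb, hv, hw', map_mul, map_sub, map_neg,
    map_one, Complex.conj_I, Complex.conj_conj]
  constructor
  · linear_combination (Complex.I * (L j)⁻¹ * (w - conj (a j) * e)) * hc
  · linear_combination (-Complex.I * (L j)⁻¹ * (v + conj (b j) * e)) * hc

/-- Applying (L^*)⁻¹ to the `x`-flow multiplies its linearized equations by L_j⁻¹ but adds the
moment (v', w'). The anti-Hermitian matrix S = ψψ_x† - ψ_xψ† satisfies Sψ = -ψ_x, since ψ_x is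
orthogonal to the unit vector ψ, and so cancels that addition. -/
theorem linearized_t {v' w' : ℂ} (hv' : v' = transverse v w (moment L 2 a) (moment L 2 b))
    (hw' : w' = transverse w v (moment L 2 b) (moment L 2 a))
    (hx : conj v' * v + conj w' * w = 0) (hx' : conj v * v' + conj w * w' = 0)
    {e : ℂ} {j : Fin N} (h1 : conj (a j) * e + cauchy L b j = 1)
    (h2 : conj (b j) * e - cauchy L a j = 0) :
    conj (flowT L a b v w v' w' j) * e + conj (a j) * (-Complex.I * (L j)⁻¹ ^ 2 * e) +
        cauchy L (flowT L b a w v w' v') j = 0 ∧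
      conj (flowT L b a w v w' v' j) * e + conj (b j) * (-Complex.I * (L j)⁻¹ ^ 2 * e) -
        cauchy L (flowT L a b v w v' w') j = 0 := by
  have ha : cauchy L a j = conj (b j) * e := (sub_eq_zero.1 h2).symm
  have hb : cauchy L b j = 1 - conj (a j) * e := by linear_combination h1
  have hm : moment L 1 b = w - 1 := by linear_combination hw
  have hT : ∀ (p q : Fin N → ℂ) (v w v' w' : ℂ), cauchy L (flowT L p q v w v' w') j =
      (L j)⁻¹ * (cauchy L (flowX L p q v w) j + moment L 1 (flowX L p q v w)) +
      (L j)⁻¹ * ((v * conj v' - v' * conj v) * (cauchy L p j + moment L 1 p) +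
        (v * conj w' - v' * conj w) * (cauchy L q j + moment L 1 q)) := by
    intro p q v w v' w'
    unfold flowT
    rw [cauchy_add, cauchy_invComb hL, cauchy_invComb hL]
    ring
  have hT' : ∀ (p q : Fin N → ℂ) (v w v' w' : ℂ), conj (flowT L p q v w v' w' j) =
      (L j)⁻¹ * conj (flowX L p q v w j) +
      (L j)⁻¹ * ((conj v * v' - conj v' * v) * conj (p j) +
        (conj v * w' - conj v' * w) * conj (q j)) := by
    intro p q v w v' w'
    simp [flowT, invComb]
  obtain ⟨x1, x2⟩ := linearized_x hL hv hw hc h1 h2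
  simp only [hT, hT', moment_flowX, ← hv', ← hw', ha, hb, hv, hm]
  constructor
  · linear_combination (L j)⁻¹ * x1 + (L j)⁻¹ * (conj (a j) * e * (hx' - hx) + w * hx - w' * hc)
  · linear_combination (L j)⁻¹ * x2 + (L j)⁻¹ * (conj (b j) * e * (hx' - hx) - v * hx + v' * hc)

end Linearized

theorem hasDerivAt_transverse {v w p q : ℝ → ℂ} {v' w' p' q' : ℂ} {s : ℝ}
    (hv : HasDerivAt v v' s) (hw : HasDerivAt w w' s) (hp : HasDerivAt p p' s)
    (hq : HasDerivAt q q' s) :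
    HasDerivAt (fun r => transverse (v r) (w r) (p r) (q r))
      (transverse (v s) (w s) p' q' + Complex.I *
        (v' * (conj (v s) * p s + conj (w s) * q s) + v s * (conj v' * p s + conj w' * q s))) s := by
  have := (hp.sub (hv.mul ((hv.star.mul hp).add (hw.star.mul hq)))).const_mul (-Complex.I)
  refine this.congr_deriv ?_
  simp only [transverse, Pi.mul_apply, Pi.add_apply, Complex.star_def]
  ring

theorem conj_transverse_orthogonal {v w : ℂ} (hc : conj v * v + conj w * w = 1) (p q : ℂ) :
    conj v * transverse v w p q + conj w * transverse w v q p = 0 := by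
  simp only [transverse]
  linear_combination (Complex.I * (conj v * p + conj w * q)) * hc

/-! ### Unitary rotations -/

theorem hasDerivAt_mulVec (U : Matrix (Fin 2) (Fin 2) ℂ) {u : ℝ → Fin 2 → ℂ} {u' : Fin 2 → ℂ}
    {s : ℝ} (hu : HasDerivAt u u' s) : HasDerivAt (fun r => U *ᵥ u r) (U *ᵥ u') s := by
  rw [hasDerivAt_pi] at hu ⊢
  intro i
  simp only [Matrix.mulVec, dotProduct]
  exact HasDerivAt.fun_sum fun k _ => (hu k).const_mul (U i k)

theorem star_mulVec_dotProduct_mulVec {U : Matrix (Fin 2) (Fin 2) ℂ}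
    (hU : U ∈ Matrix.unitaryGroup (Fin 2) ℂ) (p q : Fin 2 → ℂ) :
    star (U *ᵥ p) ⬝ᵥ (U *ᵥ q) = star p ⬝ᵥ q := by
  rw [Matrix.star_mulVec, Matrix.dotProduct_mulVec, Matrix.vecMul_vecMul,
    ← Matrix.star_eq_conjTranspose, Matrix.mem_unitaryGroup_iff'.1 hU, Matrix.vecMul_one]

/-- Unitarity preserves all the inner products involved, hence the constraint and the multiplier.
Since `l` is real, the second equation is the conjugate of the first. -/
theorem solves_mulVec_of_hasDerivAt {U : Matrix (Fin 2) (Fin 2) ℂ}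
    (hU : U ∈ Matrix.unitaryGroup (Fin 2) ℂ) {u ut ux uxx : ℝ → ℝ → Fin 2 → ℂ} {l : ℝ → ℝ → ℝ}
    (ht : ∀ t x, HasDerivAt (fun s => u s x) (ut t x) t)
    (hx : ∀ t x, HasDerivAt (fun y => u t y) (ux t x) x)
    (hxx : ∀ t x, HasDerivAt (fun y => ux t y) (uxx t x) x)
    (hc : ∀ t x, star (u t x) ⬝ᵥ u t x = 1)
    (hl : ∀ t x, ((star (u t x) ⬝ᵥ ut t x).im : ℂ) + star (ux t x) ⬝ᵥ ux t x = l t x)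
    (heq : ∀ t x, Complex.I • ut t x + uxx t x + (l t x : ℂ) • u t x = 0) :
    SatisfiesConstraint (fun t x => U *ᵥ u t x) ∧
      SolvesEulerLagrange (fun t x => U *ᵥ u t x) := by
  set ψ : ℝ → ℝ → Fin 2 → ℂ := fun t x => U *ᵥ u t x with hψ
  have e1 : dt ψ = fun t x => U *ᵥ ut t x := by
    funext t x; exact (hasDerivAt_mulVec U (ht t x)).deriv
  have e2 : dx ψ = fun t x => U *ᵥ ux t x := by
    funext t x; exact (hasDerivAt_mulVec U (hx t x)).deriv
  have e3 : dx (dx ψ) = fun t x => U *ᵥ uxx t x := by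
    rw [e2]; funext t x; exact (hasDerivAt_mulVec U (hxx t x)).deriv
  have f1 : dt (dagger ψ) = fun t x => star (U *ᵥ ut t x) := by
    funext t x; exact (hasDerivAt_mulVec U (ht t x)).star.deriv
  have f2 : dx (dagger ψ) = fun t x => star (U *ᵥ ux t x) := by
    funext t x; exact (hasDerivAt_mulVec U (hx t x)).star.deriv
  have f3 : dx (dx (dagger ψ)) = fun t x => star (U *ᵥ uxx t x) := by
    rw [f2]; funext t x; exact (hasDerivAt_mulVec U (hxx t x)).star.deriv
  have hm : ∀ t x, multiplier ψ t x = l t x := by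
    intro t x
    rw [multiplier, f2, e2, e1, dagger]
    simp only [hψ, star_mulVec_dotProduct_mulVec hU]
    exact hl t x
  have g : ∀ t x, Complex.I • (U *ᵥ ut t x) + U *ᵥ uxx t x + (l t x : ℂ) • (U *ᵥ u t x) = 0 := by
    intro t x
    rw [← Matrix.mulVec_smul, ← Matrix.mulVec_smul, ← Matrix.mulVec_add, ← Matrix.mulVec_add,
      heq, Matrix.mulVec_zero]
  refine ⟨fun t x => ?_, fun t x => ⟨?_, ?_⟩⟩
  · rw [dagger, star_mulVec_dotProduct_mulVec hU, hc]
  · rw [hm, e3, e1]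
    exact g t x
  · rw [hm, f3, f1, dagger]
    have := congrArg star (g t x)
    simp only [star_add, star_smul, star_zero, Complex.star_def, Complex.conj_I,
      Complex.conj_ofReal] at this
    exact this

/-! ### From the algebraic system to the differential equations. -/

/-- A solution of the inhomogeneous system with the soliton dispersion gives a solution of the
constrained equations. -/
theorem solves_of_system {U : Matrix (Fin 2) (Fin 2) ℂ}
    (hU : U ∈ Matrix.unitaryGroup (Fin 2) ℂ) {L : Fin N → ℂ}
    (hL : ∀ j k : Fin N, L j ≠ conj (L k)) (hinj : Function.Injective L)
    {ε a b : ℝ → ℝ → Fin N → ℂ}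
    (h1 : ∀ t x j, conj (a t x j) * ε t x j + cauchy L (b t x) j = 1)
    (h2 : ∀ t x j, conj (b t x j) * ε t x j - cauchy L (a t x) j = 0)
    (hεx : ∀ t x j, HasDerivAt (fun y => ε t y j) (-Complex.I * (L j)⁻¹ * ε t x j) x)
    (hεt : ∀ t x j, HasDerivAt (fun s => ε s x j) (-Complex.I * (L j)⁻¹ ^ 2 * ε t x j) t)
    (hax : ∀ t x j, DifferentiableAt ℝ (fun y => a t y j) x)
    (hbx : ∀ t x j, DifferentiableAt ℝ (fun y => b t y j) x)
    (hat : ∀ t x j, DifferentiableAt ℝ (fun s => a s x j) t)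
    (hbt : ∀ t x j, DifferentiableAt ℝ (fun s => b s x j) t) :
    SatisfiesConstraint (fun t x => U *ᵥ ![moment L 1 (a t x), 1 + moment L 1 (b t x)]) ∧
      SolvesEulerLagrange (fun t x => U *ᵥ ![moment L 1 (a t x), 1 + moment L 1 (b t x)]) := by
  obtain ⟨v, hv⟩ : ∃ v : ℝ → ℝ → ℂ, ∀ t x, moment L 1 (a t x) = v t x := ⟨_, fun _ _ => rfl⟩
  obtain ⟨w, hw⟩ : ∃ w : ℝ → ℝ → ℂ, ∀ t x, 1 + moment L 1 (b t x) = w t x := ⟨_, fun _ _ => rfl⟩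
  obtain ⟨v', hv'⟩ : ∃ v' : ℝ → ℝ → ℂ, ∀ t x,
      v' t x = transverse (v t x) (w t x) (moment L 2 (a t x)) (moment L 2 (b t x)) :=
    ⟨_, fun _ _ => rfl⟩
  obtain ⟨w', hw'⟩ : ∃ w' : ℝ → ℝ → ℂ, ∀ t x,
      w' t x = transverse (w t x) (v t x) (moment L 2 (b t x)) (moment L 2 (a t x)) :=
    ⟨_, fun _ _ => rfl⟩
  have hc : ∀ t x, conj (v t x) * v t x + conj (w t x) * w t x = 1 := fun t x => by
    rw [← hv, ← hw]; exact conj_mul_self_add_eq_one hL (h1 t x) (h2 t x)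
  have ho : ∀ t x, conj (v t x) * v' t x + conj (w t x) * w' t x = 0 := fun t x => by
    rw [hv', hw']; exact conj_transverse_orthogonal (hc t x) _ _
  have ho' : ∀ t x, conj (v' t x) * v t x + conj (w' t x) * w t x = 0 := fun t x => by
    have := congrArg conj (ho t x)
    simp only [map_add, map_mul, Complex.conj_conj, map_zero] at this
    linear_combination this
  have lx := fun t x j => linearized_x hL (hv t x) (hw t x) (hc t x) (h1 t x j) (h2 t x j)
  have lt := fun t x j => linearized_t hL (hv t x) (hw t x) (hc t x) (hv' t x) (hw' t x)
    (ho' t x) (ho t x) (h1 t x j) (h2 t x j)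
  have dX := fun t x => deriv_eq_of_linearized hL hinj (fun y j => h1 t y j) (fun y j => h2 t y j)
    (hεx t x) (hax t x) (hbx t x) (fun j => (lx t x j).1) fun j => (lx t x j).2
  have dT := fun t x => deriv_eq_of_linearized hL hinj (fun s j => h1 s x j) (fun s j => h2 s x j)
    (hεt t x) (hat t x) (hbt t x) (fun j => (lt t x j).1) fun j => (lt t x j).2
  have hmom : ∀ {c : ℝ → Fin N → ℂ} {c' : Fin N → ℂ} {s : ℝ} (n : ℕ),
      (∀ j, HasDerivAt (fun r => c r j) (c' j) s) →
      HasDerivAt (fun r => moment L n (c r)) (moment L n c') s :=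
    fun n h => HasDerivAt.fun_sum fun k _ => (h k).const_mul _
  have vx : ∀ t x, HasDerivAt (fun y => v t y) (v' t x) x := fun t x => by
    have := hmom 1 (dX t x).1
    rw [moment_flowX, ← hv'] at this
    simpa only [hv] using this
  have wx : ∀ t x, HasDerivAt (fun y => w t y) (w' t x) x := fun t x => by
    have := (hmom 1 (dX t x).2).const_add 1
    rw [moment_flowX, ← hw'] at this
    simpa only [hw] using this
  have vt : ∀ t x, HasDerivAt (fun s => v s x) _ t := fun t x => by
    have := hmom 1 (dT t x).1
    rw [moment_flowT] at this
    simpa only [hv, Nat.reduceAdd] using this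
  have wt : ∀ t x, HasDerivAt (fun s => w s x) _ t := fun t x => by
    have := (hmom 1 (dT t x).2).const_add 1
    rw [moment_flowT] at this
    simpa only [hw, Nat.reduceAdd] using this
  have a2 := fun t x => hmom 2 (dX t x).1
  have b2 := fun t x => hmom 2 (dX t x).2
  have vxx := fun t x =>
    (hasDerivAt_transverse (vx t x) (wx t x) (a2 t x) (b2 t x)).congr_of_eventuallyEq
      (.of_forall fun y => hv' t y)
  have wxx := fun t x =>
    (hasDerivAt_transverse (wx t x) (vx t x) (b2 t x) (a2 t x)).congr_of_eventuallyEq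
      (.of_forall fun y => hw' t y)
  simp only [moment_flowX, Nat.reduceAdd] at vxx wxx
  -- Pair ψ_x = -i(m₂ - ψ(ψ†m₂)) with ψ_x; the term along ψ drops by orthogonality.
  have hX : ∀ t x, conj (v' t x) * moment L 2 (a t x) + conj (w' t x) * moment L 2 (b t x) =
      Complex.I * (conj (v' t x) * v' t x + conj (w' t x) * w' t x) := fun t x => by
    have e1 := hv' t x
    have e2 := hw' t x
    unfold transverse at e1 e2
    linear_combination (-Complex.I * conj (v' t x)) * e1 - (Complex.I * conj (w' t x)) * e2 +
      (conj (v t x) * moment L 2 (a t x) + conj (w t x) * moment L 2 (b t x)) * ho' t x +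
      (conj (v' t x) * (moment L 2 (a t x) - v t x * (conj (v t x) * moment L 2 (a t x) +
          conj (w t x) * moment L 2 (b t x))) +
        conj (w' t x) * (moment L 2 (b t x) - w t x * (conj (v t x) * moment L 2 (a t x) +
          conj (w t x) * moment L 2 (b t x)))) * Complex.I_sq
  -- -i times a projection squares to -i times itself.
  have hPP : ∀ (v w p q : ℂ), conj v * v + conj w * w = 1 →
      transverse v w (transverse v w p q) (transverse w v q p) =
        -Complex.I * transverse v w p q := fun v w p q h => by
    have := conj_transverse_orthogonal h p q
    conv_lhs => rw [transverse]
    linear_combination Complex.I * v * this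
  have hc' : ∀ t x, conj (w t x) * w t x + conj (v t x) * v t x = 1 := fun t x => by
    rw [add_comm]; exact hc t x
  have hN : ∀ t x, ((Complex.normSq (v' t x) + Complex.normSq (w' t x) : ℝ) : ℂ) =
      conj (v' t x) * v' t x + conj (w' t x) * w' t x := fun t x => by
    rw [Complex.ofReal_add, Complex.normSq_eq_conj_mul_self, Complex.normSq_eq_conj_mul_self]
  have hpair : ∀ {p q : ℝ → ℂ} {p' q' : ℂ} {s : ℝ}, HasDerivAt p p' s → HasDerivAt q q' s →
      HasDerivAt (fun r => ![p r, q r]) ![p', q'] s := fun hp hq => by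
    rw [hasDerivAt_pi]
    intro i
    fin_cases i
    exacts [hp, hq]
  simp only [hv, hw]
  refine solves_mulVec_of_hasDerivAt hU
    -- One copy of |ψ_x|² is ψ_x†ψ_x; the other is Im(ψ†ψ_t), because ψ†ψ_t = i|ψ_x|².
    (l := fun t x => 2 * (Complex.normSq (v' t x) + Complex.normSq (w' t x)))
    (fun t x => hpair (vt t x) (wt t x)) (fun t x => hpair (vx t x) (wx t x))
    (fun t x => hpair (vxx t x) (wxx t x)) ?_ ?_ ?_
  · intro t x
    simpa [dotProduct, Fin.sum_univ_two] using hc t x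
  · intro t x
    have key : ∀ p q : ℂ, p = conj (v t x) * (transverse (v t x) (w t x) (moment L 3 (a t x))
          (moment L 3 (b t x)) +
          ((v t x * conj (v' t x) - v' t x * conj (v t x)) * moment L 2 (a t x) +
            (v t x * conj (w' t x) - v' t x * conj (w t x)) * moment L 2 (b t x))) +
        conj (w t x) * (transverse (w t x) (v t x) (moment L 3 (b t x)) (moment L 3 (a t x)) +
          ((w t x * conj (w' t x) - w' t x * conj (w t x)) * moment L 2 (b t x) +
            (w t x * conj (v' t x) - w' t x * conj (v t x)) * moment L 2 (a t x))) →
        q = conj (v' t x) * v' t x + conj (w' t x) * w' t x →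
        (p.im : ℂ) + q =
          ((2 * (Complex.normSq (v' t x) + Complex.normSq (w' t x)) : ℝ) : ℂ) := by
      intro p q hp hq
      have hp' : p = Complex.I *
          ((Complex.normSq (v' t x) + Complex.normSq (w' t x) : ℝ) : ℂ) := by
        rw [hN, ← hX, hp]
        linear_combination conj_transverse_orthogonal (hc t x) (moment L 3 (a t x))
            (moment L 3 (b t x)) +
          (conj (v' t x) * moment L 2 (a t x) + conj (w' t x) * moment L 2 (b t x)) * hc t x -
          (conj (v t x) * moment L 2 (a t x) + conj (w t x) * moment L 2 (b t x)) * ho t x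
      rw [hp', hq, ← hN, Complex.I_mul_im, Complex.ofReal_re]
      push_cast
      ring
    refine key _ _ ?_ ?_ <;> simp [dotProduct, Fin.sum_univ_two]
  · intro t x
    -- The third moments cancel: ψ_xx contributes P(P m₃) = -iP m₃ against iP m₃ from iψ_t.
    have h3 := hPP (v t x) (w t x) (moment L 3 (a t x)) (moment L 3 (b t x)) (hc t x)
    have h4 := hPP (w t x) (v t x) (moment L 3 (b t x)) (moment L 3 (a t x)) (hc' t x)
    have hl : ((2 * (Complex.normSq (v' t x) + Complex.normSq (w' t x)) : ℝ) : ℂ) =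
        2 * (conj (v' t x) * v' t x + conj (w' t x) * w' t x) := by
      rw [Complex.ofReal_mul, hN, Complex.ofReal_ofNat]
    funext i
    fin_cases i
    · simp only [hl, h3, Fin.zero_eta, Pi.add_apply, Pi.smul_apply, Matrix.cons_val_zero,
        smul_eq_mul, Pi.zero_apply]
      linear_combination (2 * Complex.I * v t x) * hX t x +
        (2 * v t x * (conj (v' t x) * v' t x + conj (w' t x) * w' t x)) * Complex.I_sq
    · simp only [hl, h4, Fin.mk_one, Pi.add_apply, Pi.smul_apply, Matrix.cons_val_one,
        Matrix.cons_val_fin_one, smul_eq_mul, Pi.zero_apply]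
      linear_combination (2 * Complex.I * w t x) * hX t x +
        (2 * w t x * (conj (v' t x) * v' t x + conj (w' t x) * w' t x)) * Complex.I_sq

/-! ### The soliton data -/

theorem matC_mulVec (L p : Fin N → ℂ) : matC L *ᵥ p = cauchy L p := by
  funext j
  simp only [Matrix.mulVec, dotProduct, matC, Matrix.of_apply, cauchy]
  exact Finset.sum_congr rfl fun k _ => by ring

theorem conjMat_mul (A B : Matrix (Fin N) (Fin N) ℂ) :
    conjMat (A * B) = conjMat A * conjMat B := Matrix.map_mul

theorem conjMat_one : conjMat (1 : Matrix (Fin N) (Fin N) ℂ) = 1 :=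
  Matrix.map_one _ (map_zero _) (map_one _)

theorem conjMat_mulVec (A : Matrix (Fin N) (Fin N) ℂ) (p : Fin N → ℂ) (j : Fin N) :
    (conjMat A *ᵥ p) j = conj ((A *ᵥ fun k => conj (p k)) j) := by
  simp [conjMat, Matrix.mulVec, dotProduct]

/-- The diagonal entries of the matrix `E`. -/
noncomputable def expFactor (L : Fin N → ℂ) (f₀ φ₀ : Fin N → ℝ) (t x : ℝ) (k : Fin N) : ℂ :=
  Complex.exp ((f L f₀ t x k : ℂ) + Complex.I * (phi L φ₀ t x k : ℂ))

theorem matY_mulVec (L : Fin N → ℂ) (f₀ φ₀ : Fin N → ℝ) (t x : ℝ) (p : Fin N → ℂ) :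
    matY L f₀ φ₀ t x *ᵥ p = cauchy L fun k => expFactor L f₀ φ₀ t x k * p k := by
  rw [matY, ← Matrix.mulVec_mulVec, matC_mulVec]
  congr 1
  funext k
  rw [matE, Matrix.mulVec_diagonal, expFactor]

theorem expFactor_ne_zero (L : Fin N → ℂ) (f₀ φ₀ : Fin N → ℝ) (t x : ℝ) (k : Fin N) :
    expFactor L f₀ φ₀ t x k ≠ 0 := Complex.exp_ne_zero _

/-- Since μ + iν = L/|L|² = 1/L^*, the phases combine into a function holomorphic in 1/L^*, which
exposes the dispersion relation. -/
theorem expFactor_eq (L : Fin N → ℂ) (f₀ φ₀ : Fin N → ℝ) (t x : ℝ) (k : Fin N) :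
    expFactor L f₀ φ₀ t x k = Complex.exp (-Complex.I * (conj (L k))⁻¹ * x -
      Complex.I * (conj (L k))⁻¹ ^ 2 * t + (f₀ k + Complex.I * φ₀ k)) := by
  have hd : (conj (L k))⁻¹ = mu L k + Complex.I * nu L k := by
    have : (conj (L k))⁻¹ = L k / ((‖L k‖ : ℂ) ^ 2) := by
      rw [Complex.inv_def, Complex.conj_conj, Complex.normSq_conj, Complex.normSq_eq_norm_sq,
        div_eq_mul_inv]
      push_cast
      rfl
    rw [this, mul_comm Complex.I, mu, nu, Complex.re_add_im]
  rw [expFactor, hd, f, phi]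
  congr 1
  push_cast
  linear_combination (nu L k * x + 2 * mu L k * nu L k * t
    + Complex.I * nu L k ^ 2 * t : ℂ) * Complex.I_sq

theorem conj_inv_expFactor (L : Fin N → ℂ) (f₀ φ₀ : Fin N → ℝ) (t x : ℝ) (k : Fin N) :
    conj (expFactor L f₀ φ₀ t x k)⁻¹ = Complex.exp (-(Complex.I * (L k)⁻¹ * x +
      Complex.I * (L k)⁻¹ ^ 2 * t + (f₀ k - Complex.I * φ₀ k))) := by
  rw [expFactor_eq, ← Complex.exp_neg, ← Complex.exp_conj]
  congr 1
  simp only [map_neg, map_add, map_sub, map_mul, map_pow, map_inv₀, Complex.conj_conj,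
    Complex.conj_I, Complex.conj_ofReal]
  ring

theorem hasDerivAt_conj_inv_expFactor_x (L : Fin N → ℂ) (f₀ φ₀ : Fin N → ℝ) (t x : ℝ)
    (k : Fin N) :
    HasDerivAt (fun y => conj (expFactor L f₀ φ₀ t y k)⁻¹)
      (-Complex.I * (L k)⁻¹ * conj (expFactor L f₀ φ₀ t x k)⁻¹) x := by
  simp only [conj_inv_expFactor]
  have h := ((((Complex.ofRealCLM.hasDerivAt (x := x)).const_mul (Complex.I * (L k)⁻¹)).add_const
    (Complex.I * (L k)⁻¹ ^ 2 * t)).add_const (f₀ k - Complex.I * φ₀ k : ℂ)).fun_neg.cexp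
  refine h.congr_deriv ?_
  simp only [Complex.ofRealCLM_apply, Complex.ofReal_one]
  ring

theorem hasDerivAt_conj_inv_expFactor_t (L : Fin N → ℂ) (f₀ φ₀ : Fin N → ℝ) (t x : ℝ)
    (k : Fin N) :
    HasDerivAt (fun s => conj (expFactor L f₀ φ₀ s x k)⁻¹)
      (-Complex.I * (L k)⁻¹ ^ 2 * conj (expFactor L f₀ φ₀ t x k)⁻¹) t := by
  simp only [conj_inv_expFactor]
  have h := ((((Complex.ofRealCLM.hasDerivAt (x := t)).const_mul
    (Complex.I * (L k)⁻¹ ^ 2)).const_add (Complex.I * (L k)⁻¹ * x)).add_const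
    (f₀ k - Complex.I * φ₀ k : ℂ)).fun_neg.cexp
  refine h.congr_deriv ?_
  simp only [Complex.ofRealCLM_apply, Complex.ofReal_one]
  ring

/-! ### Invertibility and elimination of ⟨γ|. -/

section Invertibility

variable {L : Fin N → ℂ} (hL : ∀ j k : Fin N, L j ≠ conj (L k)) (hinj : Function.Injective L)
include hL hinj

theorem isUnit_matC : IsUnit (matC L) := by
  rw [← Matrix.mulVec_injective_iff_isUnit, ← Matrix.coe_mulVecLin]
  refine (injective_iff_map_eq_zero (matC L).mulVecLin).2 fun p hp => ?_
  rw [Matrix.mulVecLin_apply, matC_mulVec] at hp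
  -- With ε = 0 and b = 0 the homogeneous system reduces to Ca = 0.
  exact (eq_zero_of_homogeneous hL hinj (ε := 0) (a := p) (b := 0) (by simp [cauchy])
    fun j => by simp [hp]).1

theorem isUnit_matC_mul_conjMat_matL : IsUnit (matC L * conjMat (matL L)) := by
  refine (isUnit_matC hL hinj).mul ?_
  rw [conjMat, matL, Matrix.diagonal_map (map_zero _), Matrix.isUnit_diagonal, Pi.isUnit_iff]
  exact fun k => isUnit_iff_ne_zero.2 (by simpa using ne_zero_of_ne_conj hL k)

theorem isUnit_matM (f₀ φ₀ : Fin N → ℝ) (t x : ℝ) : IsUnit (matM L f₀ φ₀ t x) := by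
  rw [← Matrix.mulVec_injective_iff_isUnit, ← Matrix.coe_mulVecLin]
  refine (injective_iff_map_eq_zero (matM L f₀ φ₀ t x).mulVecLin).2 fun p hp => ?_
  rw [Matrix.mulVecLin_apply, matM, Matrix.add_mulVec, Matrix.one_mulVec,
    ← Matrix.mulVec_mulVec] at hp
  set q := matY L f₀ φ₀ t x *ᵥ p with hq
  have hE := expFactor_ne_zero L f₀ φ₀ t x
  -- A kernel vector p of 1+Y^*Y yields the homogeneous solution a = Ep, b = E(Yp)^*.
  have h := (eq_zero_of_homogeneous hL hinj (ε := fun j => conj (expFactor L f₀ φ₀ t x j)⁻¹)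
    (a := fun k => expFactor L f₀ φ₀ t x k * p k)
    (b := fun k => expFactor L f₀ φ₀ t x k * conj (q k)) (fun j => ?_) fun j => ?_).1
  · funext k
    exact (mul_eq_zero.1 (congrFun h k)).resolve_left (hE k)
  · have := congrArg conj (congrFun hp j)
    rw [Pi.add_apply, conjMat_mulVec, map_add, Complex.conj_conj, matY_mulVec] at this
    simp only [Pi.zero_apply, map_zero] at this
    rw [← this, map_mul, map_inv₀]
    have := (map_ne_zero (starRingEnd ℂ)).2 (hE j)
    field_simp
  · rw [← matY_mulVec, ← hq, map_mul, map_inv₀, Complex.conj_conj]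
    have := (map_ne_zero (starRingEnd ℂ)).2 (hE j)
    field_simp
    ring

/-- From ⟨γ|CL^* = ⟨1| one gets ⟨γ|C = ⟨1|(L^*)⁻¹, so the inverse in ⟨γ| disappears. -/
theorem gammaRow_dotProduct (p : Fin N → ℂ) : gammaRow L ⬝ᵥ cauchy L p = moment L 1 p := by
  have h : gammaRow L ᵥ* (matC L * conjMat (matL L)) = fun _ => 1 := by
    rw [gammaRow, Matrix.vecMul_vecMul, Matrix.nonsing_inv_mul _
      ((Matrix.isUnit_iff_isUnit_det _).1 (isUnit_matC_mul_conjMat_matL hL hinj)),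
      Matrix.vecMul_one]
  rw [← Matrix.vecMul_vecMul, conjMat, matL, Matrix.diagonal_map (map_zero _)] at h
  rw [← matC_mulVec, Matrix.dotProduct_mulVec]
  simp only [moment, dotProduct, pow_one]
  refine Finset.sum_congr rfl fun k _ => ?_
  have hk := congrFun h k
  rw [Matrix.vecMul_diagonal] at hk
  rw [eq_inv_of_mul_eq_one_left hk]

end Invertibility

/-- The column `(1 + Y^* Y)⁻¹ |1⟩`. -/
noncomputable def resolvent (L : Fin N → ℂ) (f₀ φ₀ : Fin N → ℝ) (t x : ℝ) : Fin N → ℂ :=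
  (matM L f₀ φ₀ t x)⁻¹ *ᵥ fun _ => 1

/-- The column `E (1 + Y^* Y)⁻¹ |1⟩`. -/
noncomputable def solA (L : Fin N → ℂ) (f₀ φ₀ : Fin N → ℝ) (t x : ℝ) (k : Fin N) : ℂ :=
  expFactor L f₀ φ₀ t x k * resolvent L f₀ φ₀ t x k

/-- The column `E (Y (1 + Y^* Y)⁻¹ |1⟩)^*`. -/
noncomputable def solB (L : Fin N → ℂ) (f₀ φ₀ : Fin N → ℝ) (t x : ℝ) (k : Fin N) : ℂ :=
  expFactor L f₀ φ₀ t x k * conj ((matY L f₀ φ₀ t x *ᵥ resolvent L f₀ φ₀ t x) k)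

/-! ### The soliton data solve the inhomogeneous system. -/

section System

variable {L : Fin N → ℂ} (hL : ∀ j k : Fin N, L j ≠ conj (L k)) (hinj : Function.Injective L)
  (f₀ φ₀ : Fin N → ℝ) (t x : ℝ)

theorem conj_solB_sub (j : Fin N) :
    conj (solB L f₀ φ₀ t x j) * conj (expFactor L f₀ φ₀ t x j)⁻¹ -
      cauchy L (solA L f₀ φ₀ t x) j = 0 := by
  have h : cauchy L (solA L f₀ φ₀ t x) j = (matY L f₀ φ₀ t x *ᵥ resolvent L f₀ φ₀ t x) j := by
    rw [matY_mulVec]; rfl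
  rw [h, solB, map_mul, map_inv₀, Complex.conj_conj]
  have := (map_ne_zero (starRingEnd ℂ)).2 (expFactor_ne_zero L f₀ φ₀ t x j)
  field_simp
  ring

include hL hinj

theorem conj_resolvent_add (j : Fin N) :
    conj (resolvent L f₀ φ₀ t x j) + cauchy L (solB L f₀ φ₀ t x) j = 1 := by
  have h : matM L f₀ φ₀ t x *ᵥ resolvent L f₀ φ₀ t x = fun _ => 1 := by
    rw [resolvent, Matrix.mulVec_mulVec, Matrix.mul_nonsing_inv _
      ((Matrix.isUnit_iff_isUnit_det _).1 (isUnit_matM hL hinj f₀ φ₀ t x)), Matrix.one_mulVec]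
  rw [matM, Matrix.add_mulVec, Matrix.one_mulVec, ← Matrix.mulVec_mulVec] at h
  have := congrArg conj (congrFun h j)
  rw [Pi.add_apply, conjMat_mulVec, map_add, Complex.conj_conj, matY_mulVec _ _ _ _ _ (fun _ => _),
    map_one] at this
  exact this

theorem conj_solA_add (j : Fin N) :
    conj (solA L f₀ φ₀ t x j) * conj (expFactor L f₀ φ₀ t x j)⁻¹ +
      cauchy L (solB L f₀ φ₀ t x) j = 1 := by
  rw [← conj_resolvent_add hL hinj f₀ φ₀ t x j, solA, map_mul, map_inv₀]
  have := (map_ne_zero (starRingEnd ℂ)).2 (expFactor_ne_zero L f₀ φ₀ t x j)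
  field_simp

/-- With M = 1+Y^*Y, the intertwining M^*Y = YM gives YM⁻¹ = (M^*)⁻¹Y, hence ΩY^* = 1 - (M^*)⁻¹.
Acting on |1⟩, this is one minus the conjugate of the resolvent column. -/
theorem matOmega_mul_conjMat_mulVec :
    (matOmega L f₀ φ₀ t x * conjMat (matY L f₀ φ₀ t x)) *ᵥ (fun _ => 1) =
      cauchy L (solB L f₀ φ₀ t x) := by
  set Y := matY L f₀ φ₀ t x with hY
  set M := matM L f₀ φ₀ t x with hM
  have hMdef : M = 1 + conjMat Y * Y := rfl
  have hu := (Matrix.isUnit_iff_isUnit_det _).1 (isUnit_matM hL hinj f₀ φ₀ t x)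
  have hcM : conjMat M = 1 + Y * conjMat Y := by
    have h1 : conjMat (conjMat Y) = Y := by ext i j; simp [conjMat]
    have h2 : conjMat M = conjMat 1 + conjMat (conjMat Y * Y) := Matrix.map_add _ (map_add _) _ _
    rw [h2, conjMat_mul, h1, conjMat_one]
  have hcomm : conjMat M * Y = Y * M := by
    rw [hcM, hMdef, add_mul, mul_add, one_mul, mul_one, mul_assoc]
  have hcu : conjMat M * conjMat M⁻¹ = 1 ∧ conjMat M⁻¹ * conjMat M = 1 := by
    rw [← conjMat_mul, ← conjMat_mul, Matrix.mul_nonsing_inv _ hu, Matrix.nonsing_inv_mul _ hu]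
    exact ⟨conjMat_one, conjMat_one⟩
  have hswap : Y * M⁻¹ = conjMat M⁻¹ * Y := by
    calc Y * M⁻¹ = conjMat M⁻¹ * (conjMat M * Y) * M⁻¹ := by
          rw [← mul_assoc (conjMat M⁻¹), hcu.2, one_mul]
      _ = conjMat M⁻¹ * Y := by
          rw [hcomm, mul_assoc, mul_assoc, Matrix.mul_nonsing_inv _ hu, mul_one]
  have hone : Y * M⁻¹ * conjMat Y = 1 - conjMat M⁻¹ := by
    rw [hswap, mul_assoc, eq_sub_iff_add_eq, ← hcu.2, hcM, mul_add, mul_one, add_comm]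
  rw [matOmega, ← hY, ← hM, hone, Matrix.sub_mulVec, Matrix.one_mulVec]
  funext j
  rw [Pi.sub_apply, conjMat_mulVec]
  have := conj_resolvent_add hL hinj f₀ φ₀ t x j
  rw [resolvent, ← hM] at this
  simp only [map_one]
  linear_combination -this

theorem soliton_eq (U : Matrix (Fin 2) (Fin 2) ℂ) : soliton U L f₀ φ₀ t x =
    U *ᵥ ![moment L 1 (solA L f₀ φ₀ t x), 1 + moment L 1 (solB L f₀ φ₀ t x)] := by
  rw [soliton, matOmega_mul_conjMat_mulVec hL hinj, matOmega, ← Matrix.mulVec_mulVec, matY_mulVec,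
    gammaRow_dotProduct hL hinj, gammaRow_dotProduct hL hinj]
  rfl

end System

/-! ### Smoothness -/

section Smooth

variable (L : Fin N → ℂ) (f₀ φ₀ : Fin N → ℝ)

theorem contDiff_expFactor (k : Fin N) :
    ContDiff ℝ (⊤ : ℕ∞) fun p : ℝ × ℝ => expFactor L f₀ φ₀ p.1 p.2 k := by
  have hf : ContDiff ℝ (⊤ : ℕ∞) fun p : ℝ × ℝ => f L f₀ p.1 p.2 k :=
    ((contDiff_const.mul contDiff_snd).add (contDiff_const.mul contDiff_fst)).add contDiff_const
  have hφ : ContDiff ℝ (⊤ : ℕ∞) fun p : ℝ × ℝ => phi L φ₀ p.1 p.2 k :=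
    ((contDiff_const.mul contDiff_snd).add (contDiff_const.mul contDiff_fst)).add contDiff_const
  exact ((Complex.ofRealCLM.contDiff.comp hf).add
    (contDiff_const.mul (Complex.ofRealCLM.contDiff.comp hφ))).cexp

theorem contDiff_matY (i j : Fin N) :
    ContDiff ℝ (⊤ : ℕ∞) fun p : ℝ × ℝ => matY L f₀ φ₀ p.1 p.2 i j := by
  simp only [matY, matE, Matrix.mul_diagonal]
  exact contDiff_const.mul (contDiff_expFactor L f₀ φ₀ j)

theorem contDiff_matM (i j : Fin N) :
    ContDiff ℝ (⊤ : ℕ∞) fun p : ℝ × ℝ => matM L f₀ φ₀ p.1 p.2 i j := by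
  simp only [matM, conjMat, Matrix.add_apply, Matrix.mul_apply, Matrix.map_apply]
  refine contDiff_const.add (ContDiff.sum fun k _ => ?_)
  exact (Complex.conjCLE.contDiff.comp (contDiff_matY L f₀ φ₀ i k)).mul (contDiff_matY L f₀ φ₀ k j)

theorem contDiff_det {A : ℝ × ℝ → Matrix (Fin N) (Fin N) ℂ}
    (hA : ∀ i j, ContDiff ℝ (⊤ : ℕ∞) fun p => A p i j) :
    ContDiff ℝ (⊤ : ℕ∞) fun p => (A p).det := by
  simp only [Matrix.det_apply']
  exact ContDiff.sum fun σ _ => contDiff_const.mul (contDiff_prod fun i _ => hA _ _)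

/-- Cramer's rule: the entries are cofactors divided by a nowhere vanishing determinant. -/
theorem contDiff_inv {A : ℝ × ℝ → Matrix (Fin N) (Fin N) ℂ}
    (hA : ∀ i j, ContDiff ℝ (⊤ : ℕ∞) fun p => A p i j) (hu : ∀ p, IsUnit (A p)) (i j : Fin N) :
    ContDiff ℝ (⊤ : ℕ∞) fun p => (A p)⁻¹ i j := by
  simp only [Matrix.inv_def, Ring.inverse_eq_inv', Matrix.smul_apply, smul_eq_mul,
    Matrix.adjugate_apply]
  refine ((contDiff_det hA).inv fun p => ?_).mul (contDiff_det fun k l => ?_)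
  · exact ((Matrix.isUnit_iff_isUnit_det _).1 (hu p)).ne_zero
  · by_cases h : k = j
    · simpa [h] using contDiff_const
    · simpa [Matrix.updateRow_ne h] using hA k l

variable {L} (hL : ∀ j k : Fin N, L j ≠ conj (L k)) (hinj : Function.Injective L)
include hL hinj

theorem contDiff_resolvent (k : Fin N) :
    ContDiff ℝ (⊤ : ℕ∞) fun p : ℝ × ℝ => resolvent L f₀ φ₀ p.1 p.2 k := by
  simp only [resolvent, Matrix.mulVec, dotProduct]
  exact ContDiff.sum fun j _ => (contDiff_inv (contDiff_matM L f₀ φ₀)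
    (fun p => isUnit_matM hL hinj f₀ φ₀ p.1 p.2) k j).mul contDiff_const

theorem contDiff_solA (k : Fin N) :
    ContDiff ℝ (⊤ : ℕ∞) fun p : ℝ × ℝ => solA L f₀ φ₀ p.1 p.2 k :=
  (contDiff_expFactor L f₀ φ₀ k).mul (contDiff_resolvent f₀ φ₀ hL hinj k)

theorem contDiff_solB (k : Fin N) :
    ContDiff ℝ (⊤ : ℕ∞) fun p : ℝ × ℝ => solB L f₀ φ₀ p.1 p.2 k := by
  refine (contDiff_expFactor L f₀ φ₀ k).mul (Complex.conjCLE.contDiff.comp ?_)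
  simp only [Matrix.mulVec, dotProduct]
  exact ContDiff.sum fun j _ =>
    (contDiff_matY L f₀ φ₀ k j).mul (contDiff_resolvent f₀ φ₀ hL hinj j)

theorem contDiff_soliton (U : Matrix (Fin 2) (Fin 2) ℂ) :
    ContDiff ℝ (⊤ : ℕ∞) fun p : ℝ × ℝ => soliton U L f₀ φ₀ p.1 p.2 := by
  have hA : ContDiff ℝ (⊤ : ℕ∞) fun p : ℝ × ℝ => moment L 1 (solA L f₀ φ₀ p.1 p.2) :=
    ContDiff.sum fun k _ => contDiff_const.mul (contDiff_solA f₀ φ₀ hL hinj k)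
  have hB : ContDiff ℝ (⊤ : ℕ∞) fun p : ℝ × ℝ => 1 + moment L 1 (solB L f₀ φ₀ p.1 p.2) :=
    contDiff_const.add
      (ContDiff.sum fun k _ => contDiff_const.mul (contDiff_solB f₀ φ₀ hL hinj k))
  simp only [soliton_eq hL hinj]
  refine contDiff_pi.2 fun i => ?_
  simp only [Matrix.mulVec, dotProduct, Fin.sum_univ_two, Matrix.cons_val_zero,
    Matrix.cons_val_one, Matrix.cons_val_fin_one]
  exact (contDiff_const.mul hA).add (contDiff_const.mul hB)

end Smooth

theorem differentiableAt_slices {g : ℝ → ℝ → ℂ}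
    (hg : ContDiff ℝ (⊤ : ℕ∞) fun p : ℝ × ℝ => g p.1 p.2) (t x : ℝ) :
    DifferentiableAt ℝ (fun y => g t y) x ∧ DifferentiableAt ℝ (fun s => g s x) t := by
  have hd : Differentiable ℝ fun p : ℝ × ℝ => g p.1 p.2 := hg.differentiable (by simp)
  exact ⟨DifferentiableAt.comp x (f := fun y : ℝ => (t, y)) (hd (t, x)) (by fun_prop),
    DifferentiableAt.comp t (f := fun s : ℝ => (s, x)) (hd (t, x)) (by fun_prop)⟩

end ConstrainedNLS

theorem proposition3p2 (N : ℕ) (U : Matrix (Fin 2) (Fin 2) ℂ)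
    (hU : U ∈ Matrix.unitaryGroup (Fin 2) ℂ)
    (L : Fin N → ℂ) (hL : Function.Injective L)
    (hLconj : ∀ j k : Fin N, L j ≠ starRingEnd ℂ (L k))
    (f₀ φ₀ : Fin N → ℝ) :
    IsUnit (ConstrainedNLS.matC L * ConstrainedNLS.conjMat (ConstrainedNLS.matL L)) ∧
    (∀ t x : ℝ, IsUnit (ConstrainedNLS.matM L f₀ φ₀ t x)) ∧
    ContDiff ℝ (⊤ : ℕ∞)
      (fun p : ℝ × ℝ => ConstrainedNLS.soliton U L f₀ φ₀ p.1 p.2) ∧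
    ConstrainedNLS.SatisfiesConstraint (ConstrainedNLS.soliton U L f₀ φ₀) ∧
    ConstrainedNLS.SolvesEulerLagrange (ConstrainedNLS.soliton U L f₀ φ₀) := by
  open ConstrainedNLS in
  refine ⟨isUnit_matC_mul_conjMat_matL hLconj hL, isUnit_matM hLconj hL f₀ φ₀,
    contDiff_soliton f₀ φ₀ hLconj hL U, ?_⟩
  have e : soliton U L f₀ φ₀ = fun t x =>
      U *ᵥ ![moment L 1 (solA L f₀ φ₀ t x), 1 + moment L 1 (solB L f₀ φ₀ t x)] :=
    funext fun t => funext fun x => soliton_eq hLconj hL f₀ φ₀ t x U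
  have dA := fun k => differentiableAt_slices (g := fun t x => solA L f₀ φ₀ t x k)
    (contDiff_solA f₀ φ₀ hLconj hL k)
  have dB := fun k => differentiableAt_slices (g := fun t x => solB L f₀ φ₀ t x k)
    (contDiff_solB f₀ φ₀ hLconj hL k)
  rw [e]
  exact solves_of_system hU hLconj hL (conj_solA_add hLconj hL f₀ φ₀) (conj_solB_sub f₀ φ₀)
    (hasDerivAt_conj_inv_expFactor_x L f₀ φ₀) (hasDerivAt_conj_inv_expFactor_t L f₀ φ₀)
    (fun t x j => (dA j t x).1) (fun t x j => (dB j t x).1)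
    (fun t x j => (dA j t x).2) fun t x j => (dB j t x).2
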